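/- Let $\mathcal H_S\neq 0$ be a finite-dimensional complex Hilbert space, $A_S$ a self-adjoint operator on it with operator norm $\|A_S\|$, and $U_S$ a unitary on $\mathcal H_S$. Put $$\mathcal A_{U_S}:=\tfrac12\bigl(\lambda_{\max}(U_S^\dagger A_SU_S-A_S)-\lambda_{\min}(U_S^\dagger A_SU_S-A_S)\bigr),$$ where $\lambda_{\max},\lambda_{\min}$ are the largest and the smallest eigenvalue. An implementation set $\mathcal I=(\mathcal H_E,A_E,\rho_E,U_{SE})$ consists of a complex Hilbert space $\mathcal H_E$ of finite or infinite dimension, a (possibly unbounded) self-adjoint operator $A_E$ on $\mathcal H_E$, a density operator $\rho_E$ on $\mathcal H_E$ (positive, of trace one), and a unitary $U_{SE}$ of $\mathcal H_S\otimes\mathcal H_E$ that conserves $A_S+A_E:=A_S\otimes 1+1\otimes A_E$, i.e. maps its domain $\mathcal H_S\otimes D(A_E)$ into itself and commutes with it there. It induces the map $\Lambda_S(X):=\mathrm{Tr}_E[U_{SE}(X\otimes\rho_E)U_{SE}^\dagger]$ on operators on $\mathcal H_S$. For a state $\rho_S$ of $\mathcal H_S$ with purification $\psi_{SR}\in\mathcal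 H_S\otimes\mathcal H_R$ (any choice gives the same value) and a map $\Lambda$ on operators on $\mathcal H_S$ let $$F_e(\rho_S,\Lambda):=\sqrt{\langle\psi_{SR}|\,[1_R\otimes\Lambda](|\psi_{SR}\rangle\langle\psi_{SR}|)\,|\psi_{SR}\rangle},\qquad L_e(\rho_S,\Lambda):=\sqrt{2\,(1-F_e(\rho_S,\Lambda))},$$ and define the error of $\mathcal I$ as an implementation of $U_S$ by $$\delta_{\mathcal I}:=\max_{\rho_S}L_e\bigl(\rho_S,\;X\mapsto U_S^\dagger\Lambda_S(X)U_S\bigr).$$ Finally, for a unit vector $\phi\in\mathcal H_E$ let $V^2_{A_E}(\phi):=\|A_E\phi\|^2-\langle\phi|A_E|\phi\rangle^2$ if $\phi\in D(A_E)$ and $V^2_{A_E}(\phi):=\infty$ otherwise, and let the quantum Fisher information be $$\mathcal F(\rho_E):=\inf\Bigl\{4\sum_j q_jV_{A_E}^2(\phi_j)\Bigr\}\in[0,\infty],$$ where the infimum is over all countable decompositions $\rho_E=\sum_jq_j|\phi_j\rangle\langle\phi_j|$ with probabilities $q_j$ and unit vectors $\phi_j$. **Theorem.** Let $0\le\delta\le\sqrt2$.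 For every implementation set $\mathcal I$ with $\delta_{\mathcal I}\le\delta$, $$\sqrt{\mathcal F(\rho_E)}\;\ge\;\frac{\mathcal A_{U_S}}{\delta}-4\|A_S\|,$$ where for $\delta=0$ the quotient is read as $+\infty$ if $\mathcal A_{U_S}>0$ and as $0$ if $\mathcal A_{U_S}=0$. -/

import Mathlib

open scoped TensorProduct ENNReal InnerProductSpace

noncomputable section

namespace CoherenceCost

/-! ### Traces and partial traces

Scalar products are linear in the second argument, so `⟪x, y⟫_ℂ` is the bracket of physics. -/

section Trace

/-- The index set of a fixed orthonormal (Hilbert) basis of a Hilbert space. -/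
def basisIndex (H : Type*) [NormedAddCommGroup H] [InnerProductSpace ℂ H] [CompleteSpace H] :
    Set H :=
  (exists_hilbertBasis ℂ H).choose

/-- A fixed orthonormal (Hilbert) basis of a Hilbert space. -/
def basis (H : Type*) [NormedAddCommGroup H] [InnerProductSpace ℂ H] [CompleteSpace H] :
    HilbertBasis (basisIndex H) ℂ H :=
  (exists_hilbertBasis ℂ H).choose_spec.choose

/-- The trace `∑ i, ⟨b i, T b i⟩` of an operator. -/
def opTrace {H : Type*} [NormedAddCommGroup H] [InnerProductSpace ℂ H] [CompleteSpace H]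
    (T : H →L[ℂ] H) : ℂ :=
  ∑' i, ⟪basis H i, T (basis H i)⟫_ℂ

/-- States (density operators): positive operators of trace one. As the trace is an unconditional
sum of non-negative numbers with the nonzero value one, such an operator is trace class. -/
def IsState {H : Type*} [NormedAddCommGroup H] [InnerProductSpace ℂ H] [CompleteSpace H]
    (ρ : H →L[ℂ] H) : Prop :=
  ρ.IsPositive ∧ opTrace ρ = 1

variable {H K : Type*} [NormedAddCommGroup H] [InnerProductSpace ℂ H] [FiniteDimensional ℂ H]
  [NormedAddCommGroup K] [InnerProductSpace ℂ K]

/-- The operator `(1 ⊗ ⟨e|) T (1 ⊗ |f⟩)` on `H`, for an operator `T` on `H ⊗ K` and vectors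
`e`, `f` of `K`. -/
def block (T : H ⊗[ℂ] K →ₗ[ℂ] H ⊗[ℂ] K) (e f : K) : H →L[ℂ] H :=
  LinearMap.toContinuousLinearMap
    ((TensorProduct.rid ℂ H).toLinearMap ∘ₗ (innerₛₗ ℂ e).lTensor H ∘ₗ T ∘ₗ
      (TensorProduct.mk ℂ H K).flip f)

theorem inner_block (T : H ⊗[ℂ] K →ₗ[ℂ] H ⊗[ℂ] K) (e f : K) (s s' : H) :
    ⟪s, block T e f s'⟫_ℂ = ⟪s ⊗ₜ[ℂ] e, T (s' ⊗ₜ[ℂ] f)⟫_ℂ := by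
  have h : ∀ z : H ⊗[ℂ] K,
      ⟪s, TensorProduct.rid ℂ H ((innerₛₗ ℂ e).lTensor H z)⟫_ℂ = ⟪s ⊗ₜ[ℂ] e, z⟫_ℂ := by
    intro z
    induction z using TensorProduct.induction_on with
    | zero => simp
    | tmul a b => simp [mul_comm]
    | add a b ha hb => simp only [map_add, inner_add_right, ha, hb]
  exact h _

/-- The partial trace over the second factor, `Tr_K T = ∑ i, (1 ⊗ ⟨b i|) T (1 ⊗ |b i⟩)`. -/
def partialTrace [CompleteSpace K] (T : H ⊗[ℂ] K →ₗ[ℂ] H ⊗[ℂ] K) : H →L[ℂ] H :=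
  ∑' i, block T (basis K i) (basis K i)

end Trace

/-! ### Entanglement fidelity and entanglement Bures distance -/

section Fidelity

variable {S R : Type*} [NormedAddCommGroup S] [InnerProductSpace ℂ S] [FiniteDimensional ℂ S]
  [NormedAddCommGroup R] [InnerProductSpace ℂ R] [FiniteDimensional ℂ R]

/-- The pure state `|ψ⟩⟨ψ|`. -/
def proj {H : Type*} [NormedAddCommGroup H] [InnerProductSpace ℂ H] (ψ : H) : H →L[ℂ] H :=
  InnerProductSpace.rankOne ℂ ψ ψ

/-- The map `1_R ⊗ Λ` on operators on `S ⊗ R`: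
it sends `∑ k l, X k l ⊗ |k⟩⟨l|` to `∑ k l, Λ (X k l) ⊗ |k⟩⟨l|`, where `k`, `l` run through an
orthonormal basis of the reference space `R`. -/
def ampliation (Λ : (S →L[ℂ] S) → (S →L[ℂ] S)) (X : S ⊗[ℂ] R →ₗ[ℂ] S ⊗[ℂ] R) :
    S ⊗[ℂ] R →ₗ[ℂ] S ⊗[ℂ] R :=
  ∑ k, ∑ l, TensorProduct.map
    (Λ (block X (stdOrthonormalBasis ℂ R k) (stdOrthonormalBasis ℂ R l))).toLinearMap
    (InnerProductSpace.rankOne ℂ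
      (stdOrthonormalBasis ℂ R k) (stdOrthonormalBasis ℂ R l)).toLinearMap

/-- `ψ` in `S ⊗ R` is a purification of the state `ρ` of `S`. -/
def IsPurification [CompleteSpace R] (ψ : S ⊗[ℂ] R) (ρ : S →L[ℂ] S) : Prop :=
  partialTrace (proj ψ).toLinearMap = ρ

/-- The entanglement fidelity `√⟨ψ| (1_R ⊗ Λ)(|ψ⟩⟨ψ|) |ψ⟩`, in terms of a purification `ψ` of the
input state. -/
def entFidelity (Λ : (S →L[ℂ] S) → (S →L[ℂ] S)) (ψ : S ⊗[ℂ] R) : ℝ :=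
  √(Complex.re ⟪ψ, ampliation Λ (proj ψ).toLinearMap ψ⟫_ℂ)

/-- The entanglement Bures distance `√(2 (1 - F_e))`. -/
def entBures (Λ : (S →L[ℂ] S) → (S →L[ℂ] S)) (ψ : S ⊗[ℂ] R) : ℝ :=
  √(2 * (1 - entFidelity Λ ψ))

/-- The worst-case entanglement Bures distance between `Λ` and the identity, over all
states `ρ` of `S`; a reference space of the dimension of `S` purifies all of them. -/
def worstBures [CompleteSpace S] (Λ : (S →L[ℂ] S) → (S →L[ℂ] S)) : ℝ :=
  sSup {d : ℝ | ∃ (ρ : S →L[ℂ] S) (ψ : S ⊗[ℂ] S),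
    IsState ρ ∧ IsPurification ψ ρ ∧ d = entBures Λ ψ}

/-- The supremum in `worstBures` is over a bounded set. -/
theorem entBures_le (Λ : (S →L[ℂ] S) → (S →L[ℂ] S)) (ψ : S ⊗[ℂ] R) : entBures Λ ψ ≤ √2 :=
  Real.sqrt_le_sqrt (by have : 0 ≤ entFidelity Λ ψ := Real.sqrt_nonneg _
                        linarith)

end Fidelity

/-! ### Asymmetry of the target unitary -/

section Asymmetry

variable {S : Type*} [NormedAddCommGroup S] [InnerProductSpace ℂ S]

/-- The real eigenvalues of an operator. -/
def eigenvalueSet (X : S →L[ℂ] S) : Set ℝ :=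
  {r | Module.End.HasEigenvalue X.toLinearMap (r : ℂ)}

/-- `(λ_max(A' - A) - λ_min(A' - A)) / 2` with `A' = U† A U`. -/
def asymmetry [CompleteSpace S] (A U : S →L[ℂ] S) : ℝ :=
  (sSup (eigenvalueSet (star U * A * U - A)) - sInf (eigenvalueSet (star U * A * U - A))) / 2

end Asymmetry

/-! ### Coherence: quantum Fisher information as a convex roof -/

section Coherence

variable {E : Type*} [NormedAddCommGroup E] [InnerProductSpace ℂ E]

open Classical in
/-- The variance `⟨φ|A²|φ⟩ - ⟨φ|A|φ⟩²` of a self-adjoint, possibly unbounded, operator `A` in the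
pure state given by the unit vector `φ`; it is infinite if `φ` is not in the domain of `A`. -/
def variance (A : E →ₗ.[ℂ] E) (φ : E) : ℝ≥0∞ :=
  if h : φ ∈ A.domain then
    ENNReal.ofReal (‖A ⟨φ, h⟩‖ ^ 2 - (Complex.re ⟪φ, A ⟨φ, h⟩⟫_ℂ) ^ 2)
  else ⊤

/-- `ρ = ∑ j, q j |φ j⟩⟨φ j|` with probabilities `q j` and unit vectors `φ j`; finite
decompositions are those with `q j = 0` for almost all `j`. -/
structure IsDecomposition (ρ : E →L[ℂ] E) (q : ℕ → ℝ) (φ : ℕ → E) : Prop where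
  nonneg : ∀ j, 0 ≤ q j
  sum_one : HasSum q 1
  norm_one : ∀ j, ‖φ j‖ = 1
  sum_eq : HasSum (fun j => (q j : ℂ) • proj (φ j)) ρ

/-- The quantum Fisher information of `ρ` with respect to `A`:
the infimum of `4 ∑ j, q j V(φ j)²` over all decompositions of `ρ` into pure states. -/
def fisher (A : E →ₗ.[ℂ] E) (ρ : E →L[ℂ] E) : ℝ≥0∞ :=
  ⨅ (q : ℕ → ℝ) (φ : ℕ → E) (_ : IsDecomposition ρ q φ),
    4 * ∑' j, ENNReal.ofReal (q j) * variance A (φ j)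

end Coherence

/-! ### Implementation sets -/

section Implementation

variable {S E : Type*} [NormedAddCommGroup S] [InnerProductSpace ℂ S] [FiniteDimensional ℂ S]
  [NormedAddCommGroup E] [InnerProductSpace ℂ E] [CompleteSpace E]

/-- The inclusion of `S ⊗ D(A_E)`, the domain of `A_S + A_E`, into `S ⊗ E`. -/
def totalIncl (S : Type*) [NormedAddCommGroup S] [InnerProductSpace ℂ S] (AE : E →ₗ.[ℂ] E) :
    S ⊗[ℂ] AE.domain →ₗ[ℂ] S ⊗[ℂ] E :=
  TensorProduct.map LinearMap.id AE.domain.subtype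

/-- The operator `A_S + A_E`, that is `A_S ⊗ 1 + 1 ⊗ A_E`, on its domain `S ⊗ D(A_E)`. -/
def totalOp (AS : S →L[ℂ] S) (AE : E →ₗ.[ℂ] E) : S ⊗[ℂ] AE.domain →ₗ[ℂ] S ⊗[ℂ] E :=
  TensorProduct.map AS.toLinearMap AE.domain.subtype + TensorProduct.map LinearMap.id AE.toFun

/-- The unitary `U` of `S ⊗ E` conserves `A_S + A_E`: it maps the domain of this operator into
itself and commutes with the operator there. -/
def Conserves (AS : S →L[ℂ] S) (AE : E →ₗ.[ℂ] E) (U : (S ⊗[ℂ] E) ≃ₗᵢ[ℂ] (S ⊗[ℂ] E)) : Prop :=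
  ∀ x : S ⊗[ℂ] AE.domain, ∃ y : S ⊗[ℂ] AE.domain,
    totalIncl S AE y = U (totalIncl S AE x) ∧ totalOp AS AE y = U (totalOp AS AE x)

/-- Implementation sets with external Hilbert space `E`, for a target system `S` with the
quantity `A_S`: a self-adjoint operator `A_E`, a state `ρ_E`, and a unitary of the composite system
that conserves `A_S + A_E`. -/
structure ImplementationSet (AS : S →L[ℂ] S) (E : Type*) [NormedAddCommGroup E]
    [InnerProductSpace ℂ E] [CompleteSpace E] where
  AE : E →ₗ.[ℂ] E
  selfAdjoint : IsSelfAdjoint AE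
  ρE : E →L[ℂ] E
  isState : IsState ρE
  USE : (S ⊗[ℂ] E) ≃ₗᵢ[ℂ] (S ⊗[ℂ] E)
  conserves : Conserves AS AE USE

/-- The reduced dynamics `Λ_S(X) = Tr_E [U (X ⊗ ρ_E) U†]` of the target system. -/
def ImplementationSet.channel {AS : S →L[ℂ] S} (I : ImplementationSet AS E) (X : S →L[ℂ] S) :
    S →L[ℂ] S :=
  partialTrace (I.USE.toLinearEquiv.toLinearMap ∘ₗ
    TensorProduct.map X.toLinearMap I.ρE.toLinearMap ∘ₗ I.USE.symm.toLinearEquiv.toLinearMap)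

/-- The implementation error: the worst-case entanglement Bures distance
of `X ↦ U_S† Λ_S(X) U_S` from the identity. -/
def ImplementationSet.error [CompleteSpace S] {AS : S →L[ℂ] S} (I : ImplementationSet AS E)
    (US : S →L[ℂ] S) : ℝ :=
  worstBures fun X => star US * I.channel X * US

end Implementation

end CoherenceCost

end

/-! Let `e₁`, `e₂` be unit eigenvectors of `U†AU - A` for its largest and smallest eigenvalue, and
`fᵢ = U eᵢ`. For a pure external state `φ`, a perfect implementation would give final states `Ωᵢ =
W(eᵢ ⊗ φ)` of the form `fᵢ ⊗ κ` with one common `κ`. In general let `κ` be the mean of the partial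
products `⟨fᵢ|Ωᵢ` and put `ε² = 1 - ‖κ‖²`; the remainders `rᵢ = Ωᵢ - fᵢ ⊗ κ` satisfy `‖r₁‖² + ‖r₂‖²
= 2ε²`.

The conserved quantity, centred at the mean of `X` in `φ`, has on `Ωᵢ` the same expectation as `A`
on `eᵢ`, and its image `Mᵢ` of `Ωᵢ` has norm at most `σ + ‖A‖`, with `σ²` the variance in `φ`.
Comparing `i = 1, 2`, the contribution of `X` on the common `κ` cancels and the rest is of order
`ε`; this is `tradeoff_pure`: asymmetry `≤ ε(2σ + 3‖A‖) + 2‖A‖ε²`. The unbounded `X` enters the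
estimates only through the vectors `Mᵢ`.

For a decomposition of `ρ_E`, the mean of `‖κⱼ‖²` is the squared entanglement fidelity at `(e₁ ⊗ |1⟩
+ e₂ ⊗ |2⟩)/√2` (`hasSum_fidelity`), so the mean of `εⱼ²` is at most `δ²`. Cauchy-Schwarz
(`tradeoff_average`) carries the bound to the mixture, and the infimum over decompositions gives the
Fisher information. -/

namespace CoherenceCost

/-! ### Partial scalar products on the target factor -/

section Slice

variable {S E : Type*} [NormedAddCommGroup S] [InnerProductSpace ℂ S]
  [NormedAddCommGroup E] [InnerProductSpace ℂ E]

/-- The partial scalar product `⟨f| ⊗ 1` on `S ⊗ E`. -/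
noncomputable def slice (f : S) : S ⊗[ℂ] E →ₗ[ℂ] E :=
  (TensorProduct.lid ℂ E).toLinearMap ∘ₗ (innerₛₗ ℂ f).rTensor E

@[simp] theorem slice_tmul (f s : S) (φ : E) : slice f (s ⊗ₜ[ℂ] φ) = ⟪f, s⟫_ℂ • φ := by
  simp [slice]

theorem inner_slice (f : S) (χ : E) (z : S ⊗[ℂ] E) :
    ⟪χ, slice f z⟫_ℂ = ⟪f ⊗ₜ[ℂ] χ, z⟫_ℂ := by
  induction z using TensorProduct.induction_on with
  | zero => simp
  | tmul a b => simp
  | add a b ha hb => simp only [map_add, inner_add_right, ha, hb]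

theorem slice_inner (f : S) (χ : E) (z : S ⊗[ℂ] E) :
    ⟪slice f z, χ⟫_ℂ = ⟪z, f ⊗ₜ[ℂ] χ⟫_ℂ := by
  rw [← inner_conj_symm, inner_slice]
  exact inner_conj_symm z (f ⊗ₜ[ℂ] χ)

theorem norm_slice_le (f : S) (z : S ⊗[ℂ] E) : ‖slice f z‖ ≤ ‖f‖ * ‖z‖ := by
  by_cases h : slice f z = 0
  · rw [h, norm_zero]; positivity
  have h1 : ‖slice f z‖ * ‖slice f z‖ ≤ ‖f‖ * ‖z‖ * ‖slice f z‖ := by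
    have h2 := norm_inner_le_norm (𝕜 := ℂ) (f ⊗ₜ[ℂ] slice f z) z
    rw [← inner_slice, TensorProduct.norm_tmul, inner_self_eq_norm_sq_to_K] at h2
    simp only [norm_pow, Complex.coe_algebraMap, Complex.norm_real, norm_norm] at h2
    nlinarith
  exact le_of_mul_le_mul_right h1 (norm_pos_iff.2 h)

theorem slice_sub_left (f g : S) (z : S ⊗[ℂ] E) : slice (f - g) z = slice f z - slice g z := by
  refine ext_inner_left ℂ fun χ => ?_
  simp only [inner_sub_right, inner_slice, TensorProduct.sub_tmul, inner_sub_left]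

theorem slice_smul_left (c : ℂ) (f : S) (z : S ⊗[ℂ] E) :
    slice (c • f) z = (starRingEnd ℂ) c • slice f z := by
  refine ext_inner_left ℂ fun χ => ?_
  rw [inner_smul_right, inner_slice, inner_slice, ← TensorProduct.smul_tmul']
  exact inner_smul_left (f ⊗ₜ[ℂ] χ) z c

end Slice

/-! ### The trade-off inequality for one pure external state -/

section Core

variable {S E : Type*} [NormedAddCommGroup S] [InnerProductSpace ℂ S]
  [NormedAddCommGroup E] [InnerProductSpace ℂ E]

theorem abs_re_inner_le {H : Type*} [NormedAddCommGroup H] [InnerProductSpace ℂ H] {x y : H}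
    {p q : ℝ} (hx : ‖x‖ ≤ p) (hy : ‖y‖ ≤ q) : |(⟪x, y⟫_ℂ).re| ≤ p * q :=
  (Complex.abs_re_le_norm _).trans ((norm_inner_le_norm x y).trans
    (mul_le_mul hx hy (norm_nonneg _) ((norm_nonneg _).trans hx)))

theorem norm_sq_sub_tmul {f : S} (hf : ‖f‖ = 1) {Ω : S ⊗[ℂ] E} (hΩ : ‖Ω‖ = 1) (κ : E) :
    ‖Ω - f ⊗ₜ[ℂ] κ‖ ^ 2 = 1 - 2 * (⟪slice f Ω, κ⟫_ℂ).re + ‖κ‖ ^ 2 := by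
  have h := norm_sub_sq (𝕜 := ℂ) Ω (f ⊗ₜ[ℂ] κ)
  rw [slice_inner]
  rw [h, TensorProduct.norm_tmul, hf, hΩ]
  simp

/-- The real inequality behind the trade-off bound. -/
theorem half_sum_bounds {a ε p₁ p₂ v₁ v₂ : ℝ} (ha : 0 ≤ a) (hε : 0 ≤ ε)
    (hp : p₁ ^ 2 + p₂ ^ 2 = 2 * ε ^ 2) (hv : v₁ ^ 2 + v₂ ^ 2 ≤ 2 * a ^ 2) :
    p₁ + p₂ ≤ 2 * ε ∧ v₁ * p₁ + v₂ * p₂ ≤ 2 * (a * ε) := by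
  constructor
  · exact abs_le_of_sq_le_sq' (by nlinarith [sq_nonneg (p₁ - p₂)]) (by positivity) |>.2
  · refine abs_le_of_sq_le_sq' ?_ (by positivity) |>.2
    have : (v₁ * p₁ + v₂ * p₂) ^ 2 ≤ (v₁ ^ 2 + v₂ ^ 2) * (p₁ ^ 2 + p₂ ^ 2) := by
      nlinarith [sq_nonneg (v₁ * p₂ - v₂ * p₁)]
    rw [hp] at this
    nlinarith [mul_le_mul_of_nonneg_right hv (sq_nonneg ε)]

theorem norm_sq_sub_real_smul (x f : S) (b : ℝ) (hf : ‖f‖ = 1) :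
    ‖x - (b : ℂ) • f‖ ^ 2 = ‖x‖ ^ 2 - 2 * b * (⟪f, x⟫_ℂ).re + b ^ 2 := by
  rw [norm_sub_sq (𝕜 := ℂ), norm_smul, hf, inner_smul_right, ← inner_conj_symm x f]
  simp [-inner_conj_symm]
  ring

set_option maxHeartbeats 400000 in
/-- The trade-off bound for a pure state of the external system. The vectors `Ω i` are the final
states for two initial states of the target, `f i` the desired final states of the target. -/
theorem tradeoff_pure [CompleteSpace S] {A : S →L[ℂ] S} (hA : IsSelfAdjoint A)
    {X : E →ₗ.[ℂ] E} (hX : X.IsFormalAdjoint X) (c : ℝ) {f₁ f₂ : S} (hf₁ : ‖f₁‖ = 1)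
    (hf₂ : ‖f₂‖ = 1) {Ω₁ Ω₂ M₁ M₂ : S ⊗[ℂ] E} (hΩ₁ : ‖Ω₁‖ = 1) (hΩ₂ : ‖Ω₂‖ = 1)
    {σ : ℝ} (hσ : 0 ≤ σ) (hM₁ : ‖M₁‖ ≤ σ + ‖A‖) (hM₂ : ‖M₂‖ ≤ σ + ‖A‖)
    {ω₁ ω₂ : X.domain} (hω₁ : (ω₁ : E) = slice f₁ Ω₁) (hω₂ : (ω₂ : E) = slice f₂ Ω₂)
    (hX₁ : slice f₁ M₁ = slice (A f₁) Ω₁ + (X ω₁ - (c : ℂ) • (ω₁ : E)))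
    (hX₂ : slice f₂ M₂ = slice (A f₂) Ω₂ + (X ω₂ - (c : ℂ) • (ω₂ : E)))
    {ε : ℝ} (hε : 0 ≤ ε) (hκ : ‖(1 / 2 : ℂ) • (slice f₁ Ω₁ + slice f₂ Ω₂)‖ ^ 2 = 1 - ε ^ 2) :
    (((⟪f₁, A f₁⟫_ℂ).re - (⟪Ω₁, M₁⟫_ℂ).re) - ((⟪f₂, A f₂⟫_ℂ).re - (⟪Ω₂, M₂⟫_ℂ).re)) / 2
      ≤ ε * (2 * σ + 3 * ‖A‖) + 2 * ‖A‖ * ε ^ 2 := by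
  -- Both vectors are formed inside the domain, since `X` is applied to each of them.
  set κ : X.domain := (1 / 2 : ℂ) • (ω₁ + ω₂) with hκdef
  set u : X.domain := (1 / 2 : ℂ) • (ω₁ - ω₂) with hudef
  have hκ' : ‖(κ : E)‖ ^ 2 = 1 - ε ^ 2 := by
    rw [← hκ, hκdef]; simp [hω₁, hω₂]
  have e₁ : ω₁ = κ + u := by rw [hκdef, hudef]; module
  have e₂ : ω₂ = κ - u := by rw [hκdef, hudef]; module
  set r₁ := Ω₁ - f₁ ⊗ₜ[ℂ] (κ : E) with hr₁
  set r₂ := Ω₂ - f₂ ⊗ₜ[ℂ] (κ : E) with hr₂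
  have ff₁ : ⟪f₁, f₁⟫_ℂ = 1 := by rw [inner_self_eq_norm_sq_to_K, hf₁]; simp
  have ff₂ : ⟪f₂, f₂⟫_ℂ = 1 := by rw [inner_self_eq_norm_sq_to_K, hf₂]; simp
  have hu₁ : slice f₁ r₁ = (u : E) := by
    rw [hr₁, map_sub, slice_tmul, ff₁, ← hω₁, e₁]; simp
  have hu₂ : slice f₂ r₂ = -(u : E) := by
    rw [hr₂, map_sub, slice_tmul, ff₂, ← hω₂, e₂]; simp
  -- the sizes of the errors
  have hp : ‖r₁‖ ^ 2 + ‖r₂‖ ^ 2 = 2 * ε ^ 2 := by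
    rw [hr₁, hr₂, norm_sq_sub_tmul hf₁ hΩ₁, norm_sq_sub_tmul hf₂ hΩ₂, ← hω₁, ← hω₂, e₁, e₂]
    have : (⟪(κ : E), κ⟫_ℂ).re = ‖(κ : E)‖ ^ 2 := by
      rw [inner_self_eq_norm_sq_to_K]; norm_cast
    simp only [Submodule.coe_add, Submodule.coe_sub, inner_add_left, inner_sub_left,
      Complex.add_re, Complex.sub_re, this]
    linarith
  have hκ1 : ‖(κ : E)‖ ≤ 1 := by
    refine abs_le_of_sq_le_sq' ?_ zero_le_one |>.2
    nlinarith [sq_nonneg ε]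
  -- `±u` is the `fᵢ`-component of `rᵢ`, so `‖u‖²` is at most the mean of the `‖rᵢ‖²`.
  have hu : ‖(u : E)‖ ≤ ε := by
    have h₁ := norm_slice_le f₁ r₁
    have h₂ := norm_slice_le f₂ r₂
    rw [hu₁, hf₁, one_mul] at h₁
    rw [hu₂, hf₂, one_mul, norm_neg] at h₂
    refine abs_le_of_sq_le_sq' ?_ hε |>.2
    have := pow_le_pow_left₀ (norm_nonneg _) h₁ 2
    have := pow_le_pow_left₀ (norm_nonneg _) h₂ 2
    linarith
  -- expectation values of `A`
  set β₁ := (⟪f₁, A f₁⟫_ℂ).re with hβ₁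
  set β₂ := (⟪f₂, A f₂⟫_ℂ).re with hβ₂
  have hA' : ∀ f, ⟪A f, f⟫_ℂ = ((⟪f, A f⟫_ℂ).re : ℂ) := fun f =>
    (hA.isSymmetric f f).trans (hA.isSymmetric.coe_re_inner_self_apply f).symm
  have hA₁ : ⟪A f₁, f₁⟫_ℂ = β₁ := hA' f₁
  have hA₂ : ⟪A f₂, f₂⟫_ℂ = β₂ := hA' f₂
  have hnA₁ : ‖A f₁‖ ≤ ‖A‖ := by simpa [hf₁] using A.le_opNorm f₁
  have hnA₂ : ‖A f₂‖ ≤ ‖A‖ := by simpa [hf₂] using A.le_opNorm f₂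
  have hβ₁' : |β₁| ≤ ‖A‖ := by simpa using abs_re_inner_le hf₁.le hnA₁
  have hβ₂' : |β₂| ≤ ‖A‖ := by simpa using abs_re_inner_le hf₂.le hnA₂
  -- Centring `A` at `b` makes the terms `b⟪κ, u⟫` of `hd₁`, `hd₂` cancel the term `(β₁ + β₂)⟪κ, u⟫`
  -- of `hXu`, and it does not raise the bound on the norms of `A fᵢ`.
  set b := (β₁ + β₂) / 2 with hb
  set g₁ := A f₁ - (b : ℂ) • f₁ with hg₁
  set g₂ := A f₂ - (b : ℂ) • f₂ with hg₂
  have hv : ‖g₁‖ ^ 2 + ‖g₂‖ ^ 2 ≤ 2 * ‖A‖ ^ 2 := by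
    rw [hg₁, hg₂, norm_sq_sub_real_smul _ _ _ hf₁, norm_sq_sub_real_smul _ _ _ hf₂]
    have := pow_le_pow_left₀ (norm_nonneg _) hnA₁ 2
    have := pow_le_pow_left₀ (norm_nonneg _) hnA₂ 2
    rw [← hβ₁, ← hβ₂, show β₂ = 2 * b - β₁ by rw [hb]; ring]
    linarith [sq_nonneg b]
  obtain ⟨hps, hvp⟩ := half_sum_bounds (norm_nonneg A) hε hp hv
  -- the expansions
  have hs₁ : slice (A f₁) Ω₁ = (β₁ : ℂ) • (κ : E) + slice (A f₁) r₁ := by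
    rw [hr₁, map_sub, slice_tmul, hA₁]; abel
  have hs₂ : slice (A f₂) Ω₂ = (β₂ : ℂ) • (κ : E) + slice (A f₂) r₂ := by
    rw [hr₂, map_sub, slice_tmul, hA₂]; abel
  have hκκ : (⟪(κ : E), κ⟫_ℂ).re = 1 - ε ^ 2 := by
    rw [← hκ', inner_self_eq_norm_sq_to_K]; norm_cast
  -- The term with `X κ` is the same for both indices and drops out of the difference; the one with
  -- `X u` changes sign and survives.
  have hΩM₁ : (⟪Ω₁, M₁⟫_ℂ).re = (⟪r₁, M₁⟫_ℂ).re + β₁ * (1 - ε ^ 2)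
      + (⟪(κ : E), slice (A f₁) r₁⟫_ℂ).re + (⟪(κ : E), X κ - (c : ℂ) • (κ : E)⟫_ℂ).re
      + (⟪(κ : E), X u - (c : ℂ) • (u : E)⟫_ℂ).re := by
    have h : ⟪Ω₁, M₁⟫_ℂ = ⟪r₁, M₁⟫_ℂ + ⟪(κ : E), slice f₁ M₁⟫_ℂ := by
      rw [inner_slice]
      exact (congrArg (fun z => ⟪z, M₁⟫_ℂ) (sub_add_cancel Ω₁ (f₁ ⊗ₜ[ℂ] (κ : E))).symm).trans
        (inner_add_left r₁ (f₁ ⊗ₜ[ℂ] (κ : E)) M₁)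
    rw [h, hX₁, hs₁, e₁, X.map_add, Submodule.coe_add, ← hκκ]
    simp only [inner_add_right, inner_sub_right, inner_smul_right, smul_add, Complex.add_re,
      Complex.sub_re, Complex.re_ofReal_mul]
    ring
  have hΩM₂ : (⟪Ω₂, M₂⟫_ℂ).re = (⟪r₂, M₂⟫_ℂ).re + β₂ * (1 - ε ^ 2)
      + (⟪(κ : E), slice (A f₂) r₂⟫_ℂ).re + (⟪(κ : E), X κ - (c : ℂ) • (κ : E)⟫_ℂ).re
      - (⟪(κ : E), X u - (c : ℂ) • (u : E)⟫_ℂ).re := by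
    have h : ⟪Ω₂, M₂⟫_ℂ = ⟪r₂, M₂⟫_ℂ + ⟪(κ : E), slice f₂ M₂⟫_ℂ := by
      rw [inner_slice]
      exact (congrArg (fun z => ⟪z, M₂⟫_ℂ) (sub_add_cancel Ω₂ (f₂ ⊗ₜ[ℂ] (κ : E))).symm).trans
        (inner_add_left r₂ (f₂ ⊗ₜ[ℂ] (κ : E)) M₂)
    rw [h, hX₂, hs₂, e₂, X.map_sub, Submodule.coe_sub, ← hκκ]
    simp only [inner_add_right, inner_sub_right, inner_smul_right, smul_sub, Complex.add_re,
      Complex.sub_re, Complex.re_ofReal_mul]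
    ring
  -- `X u` has no bound of its own. Symmetry moves `X` to `κ`, where averaging `hX₁` and `hX₂`
  -- expresses `X κ - cκ` by controlled vectors.
  have hsym : (⟪(κ : E), X u - (c : ℂ) • (u : E)⟫_ℂ).re
      = (⟪X κ - (c : ℂ) • (κ : E), (u : E)⟫_ℂ).re := by
    rw [inner_sub_right, inner_sub_left, hX κ u, inner_smul_right, inner_smul_left]
    simp
  have hXκ : X κ - (c : ℂ) • (κ : E) = (1 / 2 : ℂ) • ((slice f₁ M₁ + slice f₂ M₂)
      - ((β₁ : ℂ) + β₂) • (κ : E) - (slice (A f₁) r₁ + slice (A f₂) r₂)) := by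
    rw [hX₁, hX₂, hs₁, hs₂, e₁, e₂, X.map_add, X.map_sub, Submodule.coe_add, Submodule.coe_sub]
    module
  have hXu : (⟪X κ - (c : ℂ) • (κ : E), (u : E)⟫_ℂ).re
      = ((⟪slice f₁ M₁ + slice f₂ M₂, (u : E)⟫_ℂ).re - (β₁ + β₂) * (⟪(κ : E), u⟫_ℂ).re
        - (⟪slice (A f₁) r₁ + slice (A f₂) r₂, (u : E)⟫_ℂ).re) / 2 := by
    rw [hXκ, inner_smul_left, inner_sub_left, inner_sub_left, inner_smul_left]
    have : (starRingEnd ℂ) (1 / 2) = ((1 / 2 : ℝ) : ℂ) := by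
      rw [← Complex.conj_ofReal]; norm_num
    rw [this, Complex.re_ofReal_mul, ← Complex.ofReal_add, Complex.conj_ofReal]
    simp only [Complex.sub_re, Complex.re_ofReal_mul]
    ring
  have hd₁ : (⟪(κ : E), slice (A f₁) r₁⟫_ℂ).re
      = (⟪(κ : E), slice g₁ r₁⟫_ℂ).re + b * (⟪(κ : E), u⟫_ℂ).re := by
    rw [hg₁, slice_sub_left, slice_smul_left, hu₁, Complex.conj_ofReal, inner_sub_right,
      inner_smul_right, Complex.sub_re, Complex.re_ofReal_mul]
    ring
  have hd₂ : (⟪(κ : E), slice (A f₂) r₂⟫_ℂ).re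
      = (⟪(κ : E), slice g₂ r₂⟫_ℂ).re - b * (⟪(κ : E), u⟫_ℂ).re := by
    rw [hg₂, slice_sub_left, slice_smul_left, hu₂, Complex.conj_ofReal, inner_sub_right,
      inner_smul_right, inner_neg_right, Complex.sub_re, Complex.re_ofReal_mul, Complex.neg_re]
    ring
  -- the estimates
  have n₁ := abs_le.1 (abs_re_inner_le (le_refl ‖r₁‖) hM₁)
  have n₂ := abs_le.1 (abs_re_inner_le (le_refl ‖r₂‖) hM₂)
  have n₃ := abs_le.1 (abs_re_inner_le (x := slice f₁ M₁ + slice f₂ M₂) (p := 2 * (σ + ‖A‖))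
    (by
      have h₁ := norm_slice_le f₁ M₁
      have h₂ := norm_slice_le f₂ M₂
      rw [hf₁, one_mul] at h₁
      rw [hf₂, one_mul] at h₂
      linarith [norm_add_le (slice f₁ M₁) (slice f₂ M₂)]) hu)
  have n₄ := abs_le.1 (abs_re_inner_le (x := slice (A f₁) r₁ + slice (A f₂) r₂)
    (p := 2 * (‖A‖ * ε))
    (by
      have h₁ := (norm_slice_le (A f₁) r₁).trans
        (mul_le_mul_of_nonneg_right hnA₁ (norm_nonneg _))
      have h₂ := (norm_slice_le (A f₂) r₂).trans
        (mul_le_mul_of_nonneg_right hnA₂ (norm_nonneg _))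
      linarith [norm_add_le (slice (A f₁) r₁) (slice (A f₂) r₂),
        mul_le_mul_of_nonneg_left hps (norm_nonneg A)]) hu)
  have n₅ := abs_le.1 (abs_re_inner_le hκ1 (norm_slice_le g₁ r₁))
  have n₆ := abs_le.1 (abs_re_inner_le hκ1 (norm_slice_le g₂ r₂))
  have n₇ : (β₁ - β₂) / 2 * ε ^ 2 ≤ ‖A‖ * ε ^ 2 :=
    mul_le_mul_of_nonneg_right (by linarith [abs_le.1 hβ₁', abs_le.1 hβ₂']) (sq_nonneg ε)
  have n₈ := mul_le_mul_of_nonneg_right hps (add_nonneg hσ (norm_nonneg A))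
  rw [hΩM₁, hΩM₂, hsym, hXu, hd₁, hd₂]
  -- The budget: `ε(σ + ‖A‖)` from `⟪rᵢ, Mᵢ⟫`, the same from the `fᵢ`-components of `Mᵢ` against
  -- `u`, `ε‖A‖` from `gᵢ`, and `‖A‖ε²` twice, from `A fᵢ` against `u` and from `β₁ - β₂`.
  linear_combination (n₁.1 + n₂.2 + n₃.1 + n₄.2 + n₅.1 + n₆.2 + hvp + n₈) / 2 + n₇

end Core

/-! ### Conservation laws with an unbounded external operator -/

section PureBound

variable {S E : Type*} [NormedAddCommGroup S] [InnerProductSpace ℂ S]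
  [NormedAddCommGroup E] [InnerProductSpace ℂ E]

theorem coe_slice_domain (X : E →ₗ.[ℂ] E) (f : S) (y : S ⊗[ℂ] X.domain) :
    ((slice f y : X.domain) : E) = slice f (totalIncl S X y) := by
  induction y using TensorProduct.induction_on with
  | zero => simp
  | tmul s φ => simp [totalIncl]
  | add a b ha hb => simp only [map_add, Submodule.coe_add, ha, hb]

theorem slice_totalOp [FiniteDimensional ℂ S] [CompleteSpace S] {A : S →L[ℂ] S}
    (hA : IsSelfAdjoint A) (X : E →ₗ.[ℂ] E) (f : S) (y : S ⊗[ℂ] X.domain) :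
    slice f (totalOp A X y) = slice (A f) (totalIncl S X y) + X (slice f y) := by
  induction y using TensorProduct.induction_on with
  | zero => simp
  | tmul s φ =>
    have h : ⟪f, A s⟫_ℂ = ⟪A f, s⟫_ℂ := (hA.isSymmetric f s).symm
    simp [totalOp, totalIncl, h, X.map_smul]
  | add a b ha hb => simp only [map_add, X.map_add, ha, hb]; abel

theorem isFormalAdjoint_self [CompleteSpace E] {X : E →ₗ.[ℂ] E} (hX : IsSelfAdjoint X) :
    X.IsFormalAdjoint X := by
  have h := X.adjoint_isFormalAdjoint hX.dense_domain
  rwa [LinearPMap.isSelfAdjoint_def.1 hX] at h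

/-- The final state of a conserving unitary and the action of the conserved quantity on it. -/
theorem Conserves.exists_image [FiniteDimensional ℂ S] [CompleteSpace S] {A : S →L[ℂ] S}
    (hA : IsSelfAdjoint A) {X : E →ₗ.[ℂ] E} {W : (S ⊗[ℂ] E) ≃ₗᵢ[ℂ] (S ⊗[ℂ] E)}
    (hW : Conserves A X W) {e f : S} (he : ‖e‖ = 1) (φ : X.domain) (hφ : ‖(φ : E)‖ = 1)
    {σ c : ℝ} (hσ : 0 ≤ σ) (hc : (⟪(φ : E), X φ⟫_ℂ).re = c) (hσc : ‖X φ‖ ^ 2 - c ^ 2 ≤ σ ^ 2) :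
    ∃ (ω : X.domain) (M : S ⊗[ℂ] E), (ω : E) = slice f (W (e ⊗ₜ[ℂ] (φ : E))) ∧
      slice f M = slice (A f) (W (e ⊗ₜ[ℂ] (φ : E))) + (X ω - (c : ℂ) • (ω : E)) ∧
      ‖M‖ ≤ σ + ‖A‖ ∧ (⟪W (e ⊗ₜ[ℂ] (φ : E)), M⟫_ℂ).re = (⟪e, A e⟫_ℂ).re := by
  obtain ⟨y, hy₁, hy₂⟩ := hW (e ⊗ₜ[ℂ] φ)
  have h₁ : totalIncl S X (e ⊗ₜ[ℂ] φ) = e ⊗ₜ[ℂ] (φ : E) := by simp [totalIncl]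
  have h₂ : totalOp A X (e ⊗ₜ[ℂ] φ) = A e ⊗ₜ[ℂ] (φ : E) + e ⊗ₜ[ℂ] X φ := by simp [totalOp]
  rw [h₁] at hy₁
  rw [h₂] at hy₂
  -- Subtracting a scalar preserves the conservation law, and with `c` the mean of `X` the norm of
  -- `Xφ - cφ` is the standard deviation.
  have hM : totalOp A X y - (c : ℂ) • totalIncl S X y
      = W (A e ⊗ₜ[ℂ] (φ : E) + e ⊗ₜ[ℂ] (X φ - (c : ℂ) • (φ : E))) := by
    rw [hy₁, hy₂, ← map_smul, ← map_sub, TensorProduct.tmul_sub, TensorProduct.tmul_smul]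
    congr 1
  have ee : ⟪e, e⟫_ℂ = 1 := by rw [inner_self_eq_norm_sq_to_K, he]; simp
  have pp : ⟪(φ : E), (φ : E)⟫_ℂ = 1 := by rw [inner_self_eq_norm_sq_to_K, hφ]; simp
  refine ⟨slice f y, totalOp A X y - (c : ℂ) • totalIncl S X y, ?_, ?_, ?_, ?_⟩
  · rw [coe_slice_domain, hy₁]
  · rw [map_sub, map_smul, slice_totalOp hA, coe_slice_domain, hy₁]
    abel
  · rw [hM, W.norm_map]
    refine (norm_add_le _ _).trans ?_
    rw [TensorProduct.norm_tmul, TensorProduct.norm_tmul, hφ, he, mul_one, one_mul, add_comm]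
    refine add_le_add ?_ (by simpa [he] using A.le_opNorm e)
    refine abs_le_of_sq_le_sq' ?_ hσ |>.2
    rw [norm_sq_sub_real_smul _ _ _ hφ, hc]
    linarith
  · rw [hM, W.inner_map_map]
    refine (congrArg Complex.re (inner_add_right (e ⊗ₜ[ℂ] (φ : E)) (A e ⊗ₜ[ℂ] (φ : E))
      (e ⊗ₜ[ℂ] (X φ - (c : ℂ) • (φ : E))))).trans ?_
    rw [TensorProduct.inner_tmul, TensorProduct.inner_tmul, inner_sub_right, inner_smul_right,
      ee, pp, Complex.add_re, mul_one, one_mul, mul_one, Complex.sub_re, hc]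
    simp

/-- The trade-off bound for a pure state `φ` of the external system: `κ` is the
amplitude `⟨ψ| U† W |ψ⟩ φ` for the maximally entangled state `ψ` of the two initial vectors. -/
theorem Conserves.tradeoff [CompleteSpace E] [FiniteDimensional ℂ S] [CompleteSpace S]
    {A : S →L[ℂ] S} (hA : IsSelfAdjoint A) {X : E →ₗ.[ℂ] E} (hX : IsSelfAdjoint X)
    {W : (S ⊗[ℂ] E) ≃ₗᵢ[ℂ] (S ⊗[ℂ] E)} (hW : Conserves A X W) {e₁ e₂ f₁ f₂ : S}
    (he₁ : ‖e₁‖ = 1) (he₂ : ‖e₂‖ = 1) (hf₁ : ‖f₁‖ = 1) (hf₂ : ‖f₂‖ = 1)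
    {φ : E} (hφ : ‖φ‖ = 1) {σ : ℝ} (hσ : 0 ≤ σ) (hv : variance X φ = ENNReal.ofReal (σ ^ 2))
    {ε : ℝ} (hε : 0 ≤ ε)
    (hκ : ‖(1 / 2 : ℂ) • (slice f₁ (W (e₁ ⊗ₜ[ℂ] φ)) + slice f₂ (W (e₂ ⊗ₜ[ℂ] φ)))‖ ^ 2
      = 1 - ε ^ 2) :
    (((⟪f₁, A f₁⟫_ℂ).re - (⟪e₁, A e₁⟫_ℂ).re) - ((⟪f₂, A f₂⟫_ℂ).re - (⟪e₂, A e₂⟫_ℂ).re)) / 2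
      ≤ ε * (2 * σ + 3 * ‖A‖) + 2 * ‖A‖ * ε ^ 2 := by
  by_cases h : φ ∈ X.domain
  · rw [variance, dif_pos h] at hv
    have hσc : ‖X ⟨φ, h⟩‖ ^ 2 - (⟪φ, X ⟨φ, h⟩⟫_ℂ).re ^ 2 ≤ σ ^ 2 :=
      (ENNReal.ofReal_le_ofReal_iff (sq_nonneg σ)).1 hv.le
    obtain ⟨ω₁, M₁, hω₁, hX₁, hM₁, hE₁⟩ :=
      hW.exists_image hA (f := f₁) he₁ ⟨φ, h⟩ hφ hσ rfl hσc
    obtain ⟨ω₂, M₂, hω₂, hX₂, hM₂, hE₂⟩ :=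
      hW.exists_image hA (f := f₂) he₂ ⟨φ, h⟩ hφ hσ rfl hσc
    rw [← hE₁, ← hE₂]
    exact tradeoff_pure hA (isFormalAdjoint_self hX) _ hf₁ hf₂
      (by rw [W.norm_map, TensorProduct.norm_tmul, he₁, hφ, one_mul])
      (by rw [W.norm_map, TensorProduct.norm_tmul, he₂, hφ, one_mul])
      hσ hM₁ hM₂ hω₁ hω₂ hX₁ hX₂ hε hκ
  · rw [variance, dif_neg h] at hv
    exact absurd hv.symm ENNReal.ofReal_ne_top

end PureBound

/-! ### Partial traces as convergent series -/

section PartialTrace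

variable {S E : Type*} [NormedAddCommGroup S] [InnerProductSpace ℂ S] [FiniteDimensional ℂ S]
  [NormedAddCommGroup E] [InnerProductSpace ℂ E] [CompleteSpace E]

theorem eq_sum_rankOne (T : S →L[ℂ] S) :
    T = ∑ k, ∑ l, ⟪stdOrthonormalBasis ℂ S k, T (stdOrthonormalBasis ℂ S l)⟫_ℂ •
      InnerProductSpace.rankOne ℂ (stdOrthonormalBasis ℂ S k) (stdOrthonormalBasis ℂ S l) := by
  ext s
  simp only [sum_apply, smul_apply,
    InnerProductSpace.rankOne_apply, smul_smul]
  conv_lhs => rw [← (stdOrthonormalBasis ℂ S).sum_repr' s]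
  simp only [map_sum, map_smul]
  rw [Finset.sum_comm]
  refine Finset.sum_congr rfl fun l _ => ?_
  conv_lhs => rw [← (stdOrthonormalBasis ℂ S).sum_repr' (T (stdOrthonormalBasis ℂ S l))]
  rw [Finset.smul_sum]
  exact Finset.sum_congr rfl fun k _ => by rw [smul_smul, mul_comm]

/-- Sums of operators on a finite-dimensional space converge if all matrix elements do. -/
theorem summable_of_hasSum_inner {ι : Type*} {F : ι → S →L[ℂ] S} {G : S → S → ℂ}
    (h : ∀ s s', HasSum (fun i => ⟪s, F i s'⟫_ℂ) (G s s')) : Summable F := by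
  rw [funext fun i => eq_sum_rankOne (F i)]
  exact summable_sum fun k _ => summable_sum fun l _ => (h _ _).summable.smul_const _

/-- All matrix elements must converge, not only the one wanted: `partialTrace` is a `tsum` of
operators, which would be zero without summability. -/
theorem inner_partialTrace {T : S ⊗[ℂ] E →ₗ[ℂ] S ⊗[ℂ] E} {G : S → S → ℂ}
    (h : ∀ s s', HasSum (fun i => ⟪s ⊗ₜ[ℂ] basis E i, T (s' ⊗ₜ[ℂ] basis E i)⟫_ℂ) (G s s'))
    (s s' : S) : ⟪s, partialTrace T s'⟫_ℂ = G s s' := by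
  have h' : ∀ s s', HasSum (fun i => ⟪s, block T (basis E i) (basis E i) s'⟫_ℂ) (G s s') := by
    simpa only [inner_block] using h
  have hs := (summable_of_hasSum_inner h').hasSum
  have h₁ := hs.mapL (ContinuousLinearMap.apply ℂ S s')
  have h₂ := h₁.mapL (innerSL ℂ s)
  exact h₂.unique (h' s s')

theorem inner_partialTrace_proj (ψ : S ⊗[ℂ] E) (s s' : S) :
    ⟪s, partialTrace (proj ψ).toLinearMap s'⟫_ℂ = ⟪slice s' ψ, slice s ψ⟫_ℂ := by
  refine inner_partialTrace (G := fun s s' => ⟪slice s' ψ, slice s ψ⟫_ℂ) (fun s s' => ?_) s s'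
  refine ((basis E).hasSum_inner_mul_inner (slice s' ψ) (slice s ψ)).congr_fun fun i => ?_
  rw [slice_inner, inner_slice]
  exact inner_smul_right (s ⊗ₜ[ℂ] basis E i) ψ ⟪ψ, s' ⊗ₜ[ℂ] basis E i⟫_ℂ

omit [CompleteSpace E] in
theorem hasSum_norm_inner_sq {ι : Type*} (b : HilbertBasis ι ℂ E) (x : E) :
    HasSum (fun i => ‖⟪b i, x⟫_ℂ‖ ^ 2) (‖x‖ ^ 2) := by
  have h := Complex.hasSum_re (b.hasSum_inner_mul_inner x x)
  convert h using 1
  · funext i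
    rw [← inner_conj_symm x (b i), ← Complex.normSq_eq_conj_mul_self, Complex.ofReal_re,
      Complex.normSq_eq_norm_sq]
  · rw [inner_self_eq_norm_sq_to_K]
    norm_cast

omit [FiniteDimensional ℂ S] [CompleteSpace E] in
theorem norm_slice_apply_le (W : (S ⊗[ℂ] E) ≃ₗᵢ[ℂ] (S ⊗[ℂ] E)) (s x : S) {φ : E}
    (hφ : ‖φ‖ = 1) : ‖slice s (W (x ⊗ₜ[ℂ] φ))‖ ≤ ‖s‖ * ‖x‖ := by
  refine (norm_slice_le _ _).trans_eq ?_
  rw [W.norm_map, TensorProduct.norm_tmul, hφ, mul_one]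

-- Parseval and `xy ≤ x² + y²`; the bound is uniform over bounded families, so a further sum with
-- weights `q j` converges absolutely.
omit [CompleteSpace E] in
theorem tsum_norm_inner_mul_inner_le {ι : Type*} (b : HilbertBasis ι ℂ E) (t u : E) :
    ∑' i, ‖⟪t, b i⟫_ℂ * ⟪b i, u⟫_ℂ‖ ≤ ‖t‖ ^ 2 + ‖u‖ ^ 2 := by
  refine hasSum_le (fun i => ?_) (b.summable_inner_mul_inner t u).norm.hasSum
    ((hasSum_norm_inner_sq b t).add (hasSum_norm_inner_sq b u))
  rw [norm_mul, norm_inner_symm t]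
  nlinarith [sq_nonneg (‖⟪b i, t⟫_ℂ‖ - ‖⟪b i, u⟫_ℂ‖), sq_nonneg (‖⟪b i, t⟫_ℂ‖),
    sq_nonneg (‖⟪b i, u⟫_ℂ‖)]

omit [CompleteSpace E] in
/-- Mixtures of rank-one operators on a Hilbert space have absolutely convergent traces. -/
theorem summable_mul_inner_mul_inner {ι : Type*} (b : HilbertBasis ι ℂ E) {q : ℕ → ℝ}
    (hq : ∀ j, 0 ≤ q j) (hs : Summable q) {t u : ℕ → E} {C D : ℝ} (ht : ∀ j, ‖t j‖ ≤ C)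
    (hu : ∀ j, ‖u j‖ ≤ D) :
    Summable fun p : ℕ × ι => (q p.1 : ℂ) * (⟪t p.1, b p.2⟫_ℂ * ⟪b p.2, u p.1⟫_ℂ) := by
  have hn : ∀ j i, ‖(q j : ℂ) * (⟪t j, b i⟫_ℂ * ⟪b i, u j⟫_ℂ)‖
      = q j * ‖⟪t j, b i⟫_ℂ * ⟪b i, u j⟫_ℂ‖ := fun j i => by
    rw [norm_mul, Complex.norm_real, Real.norm_of_nonneg (hq j)]
  have hb : ∀ j, Summable fun i => ‖⟪t j, b i⟫_ℂ * ⟪b i, u j⟫_ℂ‖ := fun j =>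
    (b.summable_inner_mul_inner (t j) (u j)).norm
  refine Summable.of_norm ?_
  simp only [hn]
  have h := summable_prod_of_nonneg (f := fun p : ℕ × ι =>
    q p.1 * ‖⟪t p.1, b p.2⟫_ℂ * ⟪b p.2, u p.1⟫_ℂ‖) fun p => mul_nonneg (hq _) (norm_nonneg _)
  refine h.2 ⟨fun j => (hb j).mul_left (q j), ?_⟩
  simp only [tsum_mul_left]
  refine Summable.of_nonneg_of_le (fun j => mul_nonneg (hq j) (tsum_nonneg fun i => norm_nonneg _))
    (fun j => mul_le_mul_of_nonneg_left ((tsum_norm_inner_mul_inner_le b _ _).trans ?_) (hq j))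
    (hs.mul_right (C ^ 2 + D ^ 2))
  exact add_le_add (pow_le_pow_left₀ (norm_nonneg _) (ht j) 2)
    (pow_le_pow_left₀ (norm_nonneg _) (hu j) 2)

omit [FiniteDimensional ℂ S] [CompleteSpace E] in
theorem map_rankOne (x y : S) (ρ : E →L[ℂ] E) (z : S ⊗[ℂ] E) :
    TensorProduct.map (InnerProductSpace.rankOne ℂ x y).toLinearMap ρ.toLinearMap z
      = x ⊗ₜ[ℂ] ρ (slice y z) := by
  induction z using TensorProduct.induction_on with
  | zero => simp
  | tmul s φ => simp [TensorProduct.smul_tmul]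
  | add a b ha hb => simp only [map_add, ha, hb, TensorProduct.tmul_add]

/-- Matrix elements of `Tr_E [W (|x⟩⟨y| ⊗ ρ) W†]` in terms of a decomposition of `ρ`. -/
theorem hasSum_inner_channel {A : S →L[ℂ] S} (I : ImplementationSet A E) {q : ℕ → ℝ} {φ : ℕ → E}
    (h : IsDecomposition I.ρE q φ) (x y s s' : S) :
    HasSum (fun j => (q j : ℂ) * ⟪slice s' (I.USE (y ⊗ₜ[ℂ] φ j)), slice s (I.USE (x ⊗ₜ[ℂ] φ j))⟫_ℂ)
      ⟪s, I.channel (InnerProductSpace.rankOne ℂ x y) s'⟫_ℂ := by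
  set W := I.USE
  have key : ∀ s s' : S, ∃ g : ℂ,
      HasSum (fun j => (q j : ℂ) * ⟪slice s' (W (y ⊗ₜ[ℂ] φ j)), slice s (W (x ⊗ₜ[ℂ] φ j))⟫_ℂ) g ∧
      HasSum (fun i => ⟪s ⊗ₜ[ℂ] basis E i, (W.toLinearEquiv.toLinearMap ∘ₗ
        TensorProduct.map (InnerProductSpace.rankOne ℂ x y).toLinearMap I.ρE.toLinearMap ∘ₗ
        W.symm.toLinearEquiv.toLinearMap) (s' ⊗ₜ[ℂ] basis E i)⟫_ℂ) g := by
    intro s s'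
    have hf := summable_mul_inner_mul_inner (basis E) h.nonneg h.sum_one.summable
      (fun j => norm_slice_apply_le W s' y (h.norm_one j))
      (fun j => norm_slice_apply_le W s x (h.norm_one j))
    -- One absolutely convergent double series: summing over the basis first gives Parseval for each
    -- component `j`, summing over `j` first gives the diagonal terms of the partial trace.
    refine ⟨_, hf.hasSum.prod_fiberwise fun j =>
      ((basis E).hasSum_inner_mul_inner _ _).mul_left _, ?_⟩
    rw [← (Equiv.prodComm _ _).tsum_eq]
    refine hf.prod_symm.hasSum.prod_fiberwise fun i => ?_
    have hρ := (h.sum_eq.mapL (ContinuousLinearMap.apply ℂ E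
      (slice y (W.symm (s' ⊗ₜ[ℂ] basis E i))))).mapL
      (innerSL ℂ (slice x (W.symm (s ⊗ₜ[ℂ] basis E i))))
    have e : ∀ (x s : S) (φ : E) (χ : E),
        ⟪slice x (W.symm (s ⊗ₜ[ℂ] χ)), φ⟫_ℂ = ⟪χ, slice s (W (x ⊗ₜ[ℂ] φ))⟫_ℂ := by
      intro x s φ χ
      rw [slice_inner, inner_slice, ← W.inner_map_map, W.apply_symm_apply]
    have h₁ : ⟪s ⊗ₜ[ℂ] basis E i, (W.toLinearEquiv.toLinearMap ∘ₗ
        TensorProduct.map (InnerProductSpace.rankOne ℂ x y).toLinearMap I.ρE.toLinearMap ∘ₗ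
        W.symm.toLinearEquiv.toLinearMap) (s' ⊗ₜ[ℂ] basis E i)⟫_ℂ
        = ⟪slice x (W.symm (s ⊗ₜ[ℂ] basis E i)),
          I.ρE (slice y (W.symm (s' ⊗ₜ[ℂ] basis E i)))⟫_ℂ := by
      rw [slice_inner, ← map_rankOne, ← W.inner_map_map (W.symm _), W.apply_symm_apply]
      rfl
    rw [h₁]
    refine hρ.congr_fun fun j => ?_
    have h₂ : ⟪φ j, slice y (W.symm (s' ⊗ₜ[ℂ] basis E i))⟫_ℂ
        = ⟪slice s' (W (y ⊗ₜ[ℂ] φ j)), basis E i⟫_ℂ := by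
      rw [← inner_conj_symm, e, inner_conj_symm]
    simp [proj, e, h₂]
  choose G hG₁ hG₂ using key
  rw [ImplementationSet.channel, inner_partialTrace hG₂]
  exact hG₁ s s'

end PartialTrace

/-! ### Entanglement fidelity in coordinates -/

section Fidelity

variable {S : Type*} [NormedAddCommGroup S] [InnerProductSpace ℂ S] [FiniteDimensional ℂ S]

/-- The vector `∑ k, v k ⊗ |k⟩` of `S ⊗ S`. -/
noncomputable def entangled (v : Fin (Module.finrank ℂ S) → S) : S ⊗[ℂ] S :=
  ∑ k, v k ⊗ₜ[ℂ] stdOrthonormalBasis ℂ S k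

theorem inner_entangled (v : Fin (Module.finrank ℂ S) → S) (s : S)
    (k : Fin (Module.finrank ℂ S)) :
    ⟪s ⊗ₜ[ℂ] stdOrthonormalBasis ℂ S k, entangled v⟫_ℂ = ⟪s, v k⟫_ℂ := by
  rw [← inner_slice, entangled, map_sum]
  simp only [slice_tmul, inner_sum, inner_smul_right]
  simp [OrthonormalBasis.inner_eq_ite]

theorem block_entangled (v : Fin (Module.finrank ℂ S) → S) (k l : Fin (Module.finrank ℂ S)) :
    block (proj (entangled v)).toLinearMap (stdOrthonormalBasis ℂ S k) (stdOrthonormalBasis ℂ S l)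
      = InnerProductSpace.rankOne ℂ (v k) (v l) := by
  ext s'
  refine ext_inner_left ℂ fun s => ?_
  rw [inner_block]
  have h : ⟪entangled v, s' ⊗ₜ[ℂ] stdOrthonormalBasis ℂ S l⟫_ℂ = ⟪v l, s'⟫_ℂ := by
    rw [← inner_conj_symm (v l) s', ← inner_entangled]
    exact (inner_conj_symm (entangled v) (s' ⊗ₜ[ℂ] stdOrthonormalBasis ℂ S l)).symm
  have h' : (proj (entangled v)).toLinearMap (s' ⊗ₜ[ℂ] stdOrthonormalBasis ℂ S l)
      = ⟪v l, s'⟫_ℂ • entangled v := by rw [← h]; rfl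
  rw [h', InnerProductSpace.rankOne_apply, inner_smul_right, ← inner_entangled]
  exact inner_smul_right (s ⊗ₜ[ℂ] stdOrthonormalBasis ℂ S k) (entangled v) ⟪v l, s'⟫_ℂ

theorem inner_ampliation (Λ : (S →L[ℂ] S) → (S →L[ℂ] S)) (v : Fin (Module.finrank ℂ S) → S) :
    ⟪entangled v, ampliation Λ (proj (entangled v)).toLinearMap (entangled v)⟫_ℂ
      = ∑ k, ∑ l, ⟪v k, Λ (InnerProductSpace.rankOne ℂ (v k) (v l)) (v l)⟫_ℂ := by
  have h : ∀ (Z : S →L[ℂ] S) (k l : Fin (Module.finrank ℂ S)),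
      TensorProduct.map Z.toLinearMap (InnerProductSpace.rankOne ℂ (stdOrthonormalBasis ℂ S k)
        (stdOrthonormalBasis ℂ S l)).toLinearMap (entangled v)
      = Z (v l) ⊗ₜ[ℂ] stdOrthonormalBasis ℂ S k := by
    intro Z k l
    rw [entangled, map_sum]
    simp [OrthonormalBasis.inner_eq_ite, ite_smul, TensorProduct.tmul_ite]
  rw [ampliation]
  simp only [LinearMap.sum_apply, h, block_entangled]
  rw [inner_sum]
  refine Finset.sum_congr rfl fun k _ => ?_
  rw [inner_sum]
  refine Finset.sum_congr rfl fun l _ => ?_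
  rw [← inner_conj_symm (v k), ← inner_entangled]
  exact (inner_conj_symm _ _).symm

/-- The reduced operator is `∑ k, |v k⟩⟨v k|`, because the reference vectors are orthonormal; the `v
k` need not be. -/
theorem isState_entangled [CompleteSpace S] {v : Fin (Module.finrank ℂ S) → S}
    (hv : ∑ k, ‖v k‖ ^ 2 = 1) : IsState (partialTrace (proj (entangled v)).toLinearMap) := by
  have hs : ∀ s, ⟪s, partialTrace (proj (entangled v)).toLinearMap s⟫_ℂ
      = ∑ k, ⟪v k, s⟫_ℂ * ⟪s, v k⟫_ℂ := by
    intro s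
    rw [inner_partialTrace_proj]
    have h : slice s (entangled v) = ∑ k, ⟪s, v k⟫_ℂ • stdOrthonormalBasis ℂ S k := by
      simp [entangled]
    rw [h, (stdOrthonormalBasis ℂ S).orthonormal.inner_sum]
    simp
  refine ⟨?_, ?_⟩
  · rw [ContinuousLinearMap.isPositive_iff_complex]
    intro s
    have h : ⟪s, partialTrace (proj (entangled v)).toLinearMap s⟫_ℂ
        = ((∑ k, ‖⟪s, v k⟫_ℂ‖ ^ 2 : ℝ) : ℂ) := by
      rw [hs, Complex.ofReal_sum]
      refine Finset.sum_congr rfl fun k _ => ?_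
      rw [← inner_conj_symm (v k) s, ← Complex.normSq_eq_conj_mul_self, Complex.normSq_eq_norm_sq]
    rw [← inner_conj_symm, h, Complex.conj_ofReal]
    have h₀ : 0 ≤ ∑ k, ‖⟪s, v k⟫_ℂ‖ ^ 2 := Finset.sum_nonneg fun k _ => sq_nonneg _
    exact ⟨congrArg Complex.ofReal (Complex.ofReal_re _), h₀⟩
  · rw [opTrace]
    simp only [hs]
    have h := hasSum_sum fun k (_ : k ∈ Finset.univ) =>
      (basis S).hasSum_inner_mul_inner (v k) (v k)
    rw [h.tsum_eq]
    simp only [inner_self_eq_norm_sq_to_K, ← Complex.ofReal_one, ← hv]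
    norm_cast

end Fidelity

/-! ### Averaging the trade-off over a mixture -/

section Average

/-- The Cauchy-Schwarz inequality for a countable probability distribution. -/
theorem hasSum_mul_mul_le {q x y : ℕ → ℝ} (hq : ∀ j, 0 ≤ q j) (hx : ∀ j, 0 ≤ x j)
    (hy : ∀ j, 0 ≤ y j) {a b : ℝ} (ha : 0 ≤ a) (hb : 0 ≤ b)
    (hxs : HasSum (fun j => q j * x j ^ 2) (a ^ 2)) (hys : HasSum (fun j => q j * y j ^ 2) (b ^ 2)) :
    ∃ c ≤ a * b, HasSum (fun j => q j * (x j * y j)) c := by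
  have h : ∀ z : ℕ → ℝ, ∀ j, (√(q j) * z j) ^ (2 : ℝ) = q j * z j ^ 2 := fun z j => by
    rw [Real.rpow_two, mul_pow, Real.sq_sqrt (hq j)]
  obtain ⟨c, -, hc, hs⟩ := Real.inner_le_Lp_mul_Lq_hasSum_of_nonneg Real.HolderConjugate.two_two
    (f := fun j => √(q j) * x j) (g := fun j => √(q j) * y j) ha hb
    (fun j => mul_nonneg (Real.sqrt_nonneg _) (hx j))
    (fun j => mul_nonneg (Real.sqrt_nonneg _) (hy j))
    (by simpa only [h, Real.rpow_two] using hxs) (by simpa only [h, Real.rpow_two] using hys)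
  refine ⟨c, hc, ?_⟩
  convert hs using 2 with j
  linear_combination (-(x j * y j)) * Real.mul_self_sqrt (hq j)

/-- Cauchy-Schwarz is used for the mean of `x j * y j` and for that of `x j`. The bound is asked
only where `q j ≠ 0`, since components of weight zero may have infinite variance. -/
theorem tradeoff_average {q x y : ℕ → ℝ} (hq : ∀ j, 0 ≤ q j) (hq₁ : HasSum q 1)
    (hx : ∀ j, 0 ≤ x j) (hy : ∀ j, 0 ≤ y j) {ε σ : ℝ} (hε : 0 ≤ ε) (hσ : 0 ≤ σ)
    (hxs : HasSum (fun j => q j * x j ^ 2) (ε ^ 2)) (hys : HasSum (fun j => q j * y j ^ 2) (σ ^ 2))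
    {a d : ℝ} (ha : 0 ≤ a)
    (h : ∀ j, q j ≠ 0 → d ≤ x j * (2 * y j + 3 * a) + 2 * a * x j ^ 2) :
    d ≤ ε * (2 * σ + 3 * a) + 2 * a * ε ^ 2 := by
  obtain ⟨c, hc, hcs⟩ := hasSum_mul_mul_le hq hx hy hε hσ hxs hys
  obtain ⟨m, hm, hms⟩ := hasSum_mul_mul_le hq hx (fun _ => zero_le_one) hε zero_le_one hxs
    (by simpa using hq₁)
  have hl := hq₁.mul_right d
  have hr := ((hcs.mul_left 2).add (hms.mul_left (3 * a))).add (hxs.mul_left (2 * a))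
  have := hasSum_le (fun j => ?_) hl hr
  · nlinarith [mul_le_mul_of_nonneg_left hm ha]
  · rcases eq_or_ne (q j) 0 with h0 | h0
    · simp [h0]
    · have := mul_le_mul_of_nonneg_left (h j h0) (hq j)
      linarith

/-- For `ε ≤ 1/2` the quadratic term is at most `aε`, which turns `3a` into `4a`; for `ε ≥ 1/2` the
trivial bound gives `d ≤ 2a ≤ 4aε`. -/
theorem le_mul_of_tradeoff {a d σ ε δ : ℝ} (ha : 0 ≤ a) (hσ : 0 ≤ σ) (hε : 0 ≤ ε) (hεδ : ε ≤ δ)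
    (hd : d ≤ 2 * a) (h : d ≤ ε * (2 * σ + 3 * a) + 2 * a * ε ^ 2) :
    d ≤ (2 * σ + 4 * a) * δ := by
  have h₁ := mul_le_mul_of_nonneg_left hεδ (show 0 ≤ 2 * σ + 4 * a by positivity)
  refine le_trans ?_ h₁
  rcases le_total ε (1 / 2) with h₂ | h₂
  · nlinarith [mul_nonneg (mul_nonneg ha hε) (sub_nonneg.2 h₂)]
  · nlinarith [mul_le_mul_of_nonneg_left h₂ ha, mul_nonneg hσ hε]

end Average

/-! ### From the implementation error to amplitudes -/

section Error

variable {S E : Type*} [NormedAddCommGroup S] [InnerProductSpace ℂ S] [FiniteDimensional ℂ S]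
  [CompleteSpace S] [NormedAddCommGroup E] [InnerProductSpace ℂ E] [CompleteSpace E]

theorem entBures_le_worstBures (Λ : (S →L[ℂ] S) → (S →L[ℂ] S)) {ρ : S →L[ℂ] S}
    {ψ : S ⊗[ℂ] S} (hρ : IsState ρ) (hψ : IsPurification ψ ρ) : entBures Λ ψ ≤ worstBures Λ := by
  have hb : BddAbove {d : ℝ | ∃ (ρ : S →L[ℂ] S) (ψ : S ⊗[ℂ] S),
      IsState ρ ∧ IsPurification ψ ρ ∧ d = entBures Λ ψ} := by
    refine ⟨√2, ?_⟩
    rintro d ⟨ρ, ψ, -, -, rfl⟩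
    exact entBures_le Λ ψ
  exact le_csSup hb ⟨ρ, ψ, hρ, hψ, rfl⟩

/-- The squared entanglement fidelity in terms of a decomposition of the external state. -/
theorem hasSum_fidelity {A : S →L[ℂ] S} (I : ImplementationSet A E) {q : ℕ → ℝ} {φ : ℕ → E}
    (h : IsDecomposition I.ρE q φ) (U : S →L[ℂ] S) (v : Fin (Module.finrank ℂ S) → S) :
    HasSum (fun j => q j * ‖∑ k, slice (U (v k)) (I.USE (v k ⊗ₜ[ℂ] φ j))‖ ^ 2)
      (⟪entangled v, ampliation (fun X => star U * I.channel X * U)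
        (proj (entangled v)).toLinearMap (entangled v)⟫_ℂ).re := by
  have hs := hasSum_sum fun k (_ : k ∈ Finset.univ) => hasSum_sum fun l (_ : l ∈ Finset.univ) =>
    hasSum_inner_channel I h (v k) (v l) (U (v k)) (U (v l))
  rw [inner_ampliation]
  have e : ∀ k l, ⟪v k, (star U * I.channel (InnerProductSpace.rankOne ℂ (v k) (v l)) * U) (v l)⟫_ℂ
      = ⟪U (v k), I.channel (InnerProductSpace.rankOne ℂ (v k) (v l)) (U (v l))⟫_ℂ := fun k l =>
    ContinuousLinearMap.adjoint_inner_right U _ _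
  simp only [e]
  refine (Complex.hasSum_re hs).congr_fun fun j => ?_
  have h₁ : (⟪∑ k, slice (U (v k)) (I.USE (v k ⊗ₜ[ℂ] φ j)),
      ∑ k, slice (U (v k)) (I.USE (v k ⊗ₜ[ℂ] φ j))⟫_ℂ).re
      = ‖∑ k, slice (U (v k)) (I.USE (v k ⊗ₜ[ℂ] φ j))‖ ^ 2 := by
    rw [inner_self_eq_norm_sq_to_K]; norm_cast
  simp only [← Finset.mul_sum]
  rw [Complex.re_ofReal_mul, ← h₁, inner_sum]
  simp only [sum_inner]

/-- The error of an implementation set bounds the loss of amplitude for the maximally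
entangled state of two vectors of the target system. -/
theorem exists_hasSum_amplitude {A : S →L[ℂ] S} (I : ImplementationSet A E) {q : ℕ → ℝ}
    {φ : ℕ → E} (h : IsDecomposition I.ρE q φ) (U : S →L[ℂ] S) {δ : ℝ} (hδ : 0 ≤ δ)
    (hI : I.error U ≤ δ) (hS : 2 ≤ Module.finrank ℂ S) {e₁ e₂ : S} (he₁ : ‖e₁‖ = 1)
    (he₂ : ‖e₂‖ = 1) :
    ∃ p : ℝ, 1 - p ≤ δ ^ 2 ∧ HasSum (fun j => q j * ‖(1 / 2 : ℂ) •
      (slice (U e₁) (I.USE (e₁ ⊗ₜ[ℂ] φ j)) + slice (U e₂) (I.USE (e₂ ⊗ₜ[ℂ] φ j)))‖ ^ 2) p := by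
  let k₁ : Fin (Module.finrank ℂ S) := ⟨0, by omega⟩
  let k₂ : Fin (Module.finrank ℂ S) := ⟨1, by omega⟩
  have hk : k₁ ≠ k₂ := by simp [k₁, k₂]
  let r : ℂ := ((√2)⁻¹ : ℝ)
  let v : Fin (Module.finrank ℂ S) → S := Pi.single k₁ (r • e₁) + Pi.single k₂ (r • e₂)
  have hr : r * r = 1 / 2 := by
    rw [← Complex.ofReal_mul, ← mul_inv, Real.mul_self_sqrt zero_le_two]
    norm_num
  have hr' : ‖r‖ ^ 2 = 1 / 2 := by
    rw [Complex.norm_real, Real.norm_eq_abs, sq_abs, inv_pow, Real.sq_sqrt zero_le_two, one_div]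
  have v₁ : v k₁ = r • e₁ := by simp [v, hk]
  have v₂ : v k₂ = r • e₂ := by simp [v, hk.symm]
  have v₀ : ∀ k, k ≠ k₁ ∧ k ≠ k₂ → v k = 0 := fun k hk' => by simp [v, hk'.1, hk'.2]
  have hv : ∑ k, ‖v k‖ ^ 2 = 1 := by
    rw [Fintype.sum_eq_add k₁ k₂ hk fun k hk' => by simp [v₀ k hk'], v₁, v₂, norm_smul, norm_smul,
      he₁, he₂, mul_one, hr']
    norm_num
  have hsum : ∀ j, ∑ k, slice (U (v k)) (I.USE (v k ⊗ₜ[ℂ] φ j)) = (1 / 2 : ℂ) •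
      (slice (U e₁) (I.USE (e₁ ⊗ₜ[ℂ] φ j)) + slice (U e₂) (I.USE (e₂ ⊗ₜ[ℂ] φ j))) := by
    intro j
    have hc : ∀ e : S, slice (U (r • e)) (I.USE ((r • e) ⊗ₜ[ℂ] φ j))
        = (1 / 2 : ℂ) • slice (U e) (I.USE (e ⊗ₜ[ℂ] φ j)) := by
      intro e
      rw [map_smul, slice_smul_left, ← TensorProduct.smul_tmul', map_smul, map_smul, smul_smul,
        Complex.conj_ofReal, hr]
    rw [Fintype.sum_eq_add k₁ k₂ hk fun k hk' => by simp [v₀ k hk'], v₁, v₂, hc, hc, smul_add]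
  have hs := hasSum_fidelity I h U v
  simp only [hsum] at hs
  refine ⟨_, ?_, hs⟩
  have hb : entBures (fun X => star U * I.channel X * U) (entangled v) ≤ δ :=
    (entBures_le_worstBures _ (isState_entangled hv) rfl).trans hI
  have hp : 0 ≤ (⟪entangled v, ampliation (fun X => star U * I.channel X * U)
        (proj (entangled v)).toLinearMap (entangled v)⟫_ℂ).re :=
    hs.nonneg fun j => mul_nonneg (h.nonneg j) (sq_nonneg _)
  rw [entBures, Real.sqrt_le_left hδ, entFidelity] at hb
  -- With `F` the fidelity, `1 - F² ≤ 2(1 - F) ≤ δ²`.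
  nlinarith [Real.sq_sqrt hp, sq_nonneg (1 - √((⟪entangled v,
    ampliation (fun X => star U * I.channel X * U) (proj (entangled v)).toLinearMap
      (entangled v)⟫_ℂ).re))]

end Error

/-! ### Extremal eigenvectors of `U†AU - A` -/

section Eigenvalues

variable {S : Type*} [NormedAddCommGroup S] [InnerProductSpace ℂ S] [FiniteDimensional ℂ S]

theorem finite_eigenvalueSet (D : S →L[ℂ] S) : (eigenvalueSet D).Finite :=
  (Module.End.finite_hasEigenvalue D.toLinearMap).preimage Complex.ofReal_injective.injOn

theorem eigenvalueSet_nonempty [CompleteSpace S] [Nontrivial S] {D : S →L[ℂ] S}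
    (hD : IsSelfAdjoint D) : (eigenvalueSet D).Nonempty :=
  ⟨_, hD.isSymmetric.hasEigenvalue_eigenvalues rfl ⟨0, Module.finrank_pos⟩⟩

omit [FiniteDimensional ℂ S] in
theorem exists_unit_eigenvector {D : S →L[ℂ] S} {r : ℝ} (hr : r ∈ eigenvalueSet D) :
    ∃ e : S, ‖e‖ = 1 ∧ Module.End.HasEigenvector D.toLinearMap (r : ℂ) e := by
  obtain ⟨e, he⟩ := Module.End.HasEigenvalue.exists_hasEigenvector hr
  have h0 : ‖e‖ ≠ 0 := norm_ne_zero_iff.2 he.2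
  refine ⟨((‖e‖⁻¹ : ℝ) : ℂ) • e, ?_, Submodule.smul_mem _ _ he.1, ?_⟩
  · rw [norm_smul, Complex.norm_real, norm_inv, norm_norm, inv_mul_cancel₀ h0]
  · exact smul_ne_zero (by simpa using he.2) he.2

theorem two_le_finrank_of_hasEigenvector {D : Module.End ℂ S} {r₁ r₂ : ℂ} (h : r₁ ≠ r₂)
    {e₁ e₂ : S} (h₁ : D.HasEigenvector r₁ e₁) (h₂ : D.HasEigenvector r₂ e₂) :
    2 ≤ Module.finrank ℂ S := by
  have hl := Module.End.eigenvectors_linearIndependent' D ![r₁, r₂]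
    (by intro i j hij; fin_cases i <;> fin_cases j <;> simp_all) ![e₁, e₂]
    (by intro i; fin_cases i <;> simpa)
  simpa using hl.fintype_card_le_finrank

omit [FiniteDimensional ℂ S] in
theorem re_inner_sub_of_hasEigenvector [CompleteSpace S] {A U : S →L[ℂ] S} {r : ℝ} {e : S}
    (he : ‖e‖ = 1)
    (h : Module.End.HasEigenvector (star U * A * U - A).toLinearMap (r : ℂ) e) :
    (⟪U e, A (U e)⟫_ℂ).re - (⟪e, A e⟫_ℂ).re = r := by
  have h₁ : (star U * A * U - A) e = (r : ℂ) • e := h.apply_eq_smul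
  have h₂ : ⟪e, (star U * A * U - A) e⟫_ℂ = ⟪U e, A (U e)⟫_ℂ - ⟪e, A e⟫_ℂ := by
    rw [sub_apply, inner_sub_right]
    exact congrArg (· - ⟪e, A e⟫_ℂ) (ContinuousLinearMap.adjoint_inner_right U e (A (U e)))
  rw [← Complex.sub_re, ← h₂, h₁, inner_smul_right, inner_self_eq_norm_sq_to_K, he]
  simp

end Eigenvalues

/-! ### Assembly of the bound -/

section Final

variable {S E : Type*} [NormedAddCommGroup S] [InnerProductSpace ℂ S] [FiniteDimensional ℂ S]
  [CompleteSpace S] [Nontrivial S] [NormedAddCommGroup E] [InnerProductSpace ℂ E] [CompleteSpace E]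

/-- The trade-off bound for a decomposition of the external state with finite mean variance. -/
theorem asymmetry_le {A : S →L[ℂ] S} (hA : IsSelfAdjoint A) {U : S →L[ℂ] S}
    (hU : U ∈ unitary (S →L[ℂ] S)) {δ : ℝ} (hδ : 0 ≤ δ) (I : ImplementationSet A E)
    (hI : I.error U ≤ δ) {q : ℕ → ℝ} {φ : ℕ → E} (h : IsDecomposition I.ρE q φ) {V : ℝ}
    (hV₀ : 0 ≤ V) (hV : ∑' j, ENNReal.ofReal (q j) * variance I.AE (φ j) = ENNReal.ofReal V) :
    asymmetry A U ≤ (2 * √V + 4 * ‖A‖) * δ := by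
  set D := star U * A * U - A with hDdef
  have hD : IsSelfAdjoint D := (hA.conjugate' U).sub hA
  obtain ⟨e₁, he₁, hv₁⟩ := exists_unit_eigenvector
    ((eigenvalueSet_nonempty hD).csSup_mem (finite_eigenvalueSet D))
  obtain ⟨e₂, he₂, hv₂⟩ := exists_unit_eigenvector
    ((eigenvalueSet_nonempty hD).csInf_mem (finite_eigenvalueSet D))
  have hR : 0 ≤ (2 * √V + 4 * ‖A‖) * δ := by positivity
  -- Distinct eigenvalues force dimension at least two, which leaves room for two orthogonal
  -- reference vectors.
  rcases eq_or_ne (sSup (eigenvalueSet D)) (sInf (eigenvalueSet D)) with heq | hne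
  · rw [asymmetry, ← hDdef, heq, sub_self, zero_div]
    exact hR
  have hS := two_le_finrank_of_hasEigenvector (Complex.ofReal_injective.ne hne) hv₁ hv₂
  have hUn : ∀ e, ‖U e‖ = ‖e‖ := fun e => by
    rw [← sq_eq_sq₀ (norm_nonneg _) (norm_nonneg _)]
    have : ⟪U e, U e⟫_ℂ = ⟪e, e⟫_ℂ := by
      rw [← ContinuousLinearMap.adjoint_inner_right]
      exact congrArg (fun T : S →L[ℂ] S => ⟪e, T e⟫_ℂ) (Unitary.star_mul_self_of_mem hU)
    rw [inner_self_eq_norm_sq_to_K, inner_self_eq_norm_sq_to_K] at this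
    exact_mod_cast this
  have hf₁ : ‖U e₁‖ = 1 := (hUn e₁).trans he₁
  have hf₂ : ‖U e₂‖ = 1 := (hUn e₂).trans he₂
  have hasy : asymmetry A U = (((⟪U e₁, A (U e₁)⟫_ℂ).re - (⟪e₁, A e₁⟫_ℂ).re)
      - ((⟪U e₂, A (U e₂)⟫_ℂ).re - (⟪e₂, A e₂⟫_ℂ).re)) / 2 := by
    rw [re_inner_sub_of_hasEigenvector he₁ hv₁, re_inner_sub_of_hasEigenvector he₂ hv₂, asymmetry]
  have hAe : ∀ e : S, ‖e‖ = 1 → |(⟪e, A e⟫_ℂ).re| ≤ ‖A‖ := fun e he => by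
    simpa using abs_re_inner_le he.le (by simpa [he] using A.le_opNorm e : ‖A e‖ ≤ ‖A‖)
  obtain ⟨p, hp, hps⟩ := exists_hasSum_amplitude I h U hδ hI hS he₁ he₂
  set κ : ℕ → E := fun j => (1 / 2 : ℂ) •
      (slice (U e₁) (I.USE (e₁ ⊗ₜ[ℂ] φ j)) + slice (U e₂) (I.USE (e₂ ⊗ₜ[ℂ] φ j))) with hκ
  have hκ1 : ∀ j, 0 ≤ 1 - ‖κ j‖ ^ 2 := by
    intro j
    have h₁ := norm_slice_apply_le I.USE (U e₁) e₁ (h.norm_one j)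
    have h₂ := norm_slice_apply_le I.USE (U e₂) e₂ (h.norm_one j)
    rw [hf₁, he₁] at h₁
    rw [hf₂, he₂] at h₂
    have h₃ : ‖κ j‖ ≤ 1 := by
      rw [hκ, norm_smul]
      have := norm_add_le (slice (U e₁) (I.USE (e₁ ⊗ₜ[ℂ] φ j)))
        (slice (U e₂) (I.USE (e₂ ⊗ₜ[ℂ] φ j)))
      norm_num
      linarith
    nlinarith [norm_nonneg (κ j)]
  have hε : HasSum (fun j => q j * √(1 - ‖κ j‖ ^ 2) ^ 2) (1 - p) := by
    refine (h.sum_one.sub hps).congr_fun fun j => ?_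
    rw [Real.sq_sqrt (hκ1 j)]
    ring
  have hp₀ : 0 ≤ 1 - p := hε.nonneg fun j => mul_nonneg (h.nonneg j) (sq_nonneg _)
  have hσ : HasSum (fun j => q j * √(variance I.AE (φ j)).toReal ^ 2) (√V ^ 2) := by
    have hs := ENNReal.hasSum_toReal (hV.trans_ne ENNReal.ofReal_ne_top)
    rw [← ENNReal.tsum_toReal_eq, hV, ENNReal.toReal_ofReal hV₀] at hs
    · rw [Real.sq_sqrt hV₀]
      refine hs.congr_fun fun j => ?_
      rw [ENNReal.toReal_mul, ENNReal.toReal_ofReal (h.nonneg j),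
        Real.sq_sqrt ENNReal.toReal_nonneg]
    · exact ENNReal.ne_top_of_tsum_ne_top (hV.trans_ne ENNReal.ofReal_ne_top)
  have hav := tradeoff_average (d := asymmetry A U) h.nonneg h.sum_one
    (fun j => Real.sqrt_nonneg (1 - ‖κ j‖ ^ 2))
    (fun j => Real.sqrt_nonneg (variance I.AE (φ j)).toReal) (Real.sqrt_nonneg (1 - p))
    (Real.sqrt_nonneg V) (by rwa [Real.sq_sqrt hp₀]) hσ (norm_nonneg A) (fun j hj => by
      have hv : variance I.AE (φ j) ≠ ⊤ := by
        intro htop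
        refine ENNReal.ne_top_of_tsum_ne_top (hV.trans_ne ENNReal.ofReal_ne_top) j ?_
        have : 0 < q j := (h.nonneg j).lt_of_ne' hj
        rw [htop, ENNReal.mul_top (by simpa using this)]
      rw [hasy]
      refine I.conserves.tradeoff hA I.selfAdjoint he₁ he₂ hf₁ hf₂ (h.norm_one j)
        (Real.sqrt_nonneg _) ?_ (Real.sqrt_nonneg _) ?_
      · rw [Real.sq_sqrt ENNReal.toReal_nonneg, ENNReal.ofReal_toReal hv]
      · rw [Real.sq_sqrt (hκ1 j), sub_sub_cancel])
  refine le_mul_of_tradeoff (norm_nonneg A) (Real.sqrt_nonneg V) (Real.sqrt_nonneg (1 - p))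
    ((Real.sqrt_le_left hδ).2 hp) ?_ hav
  rw [hasy]
  linarith [abs_le.1 (hAe _ he₁), abs_le.1 (hAe _ he₂), abs_le.1 (hAe _ hf₁), abs_le.1 (hAe _ hf₂)]

end Final

end CoherenceCost

theorem theorem1
    {S : Type*} [NormedAddCommGroup S] [InnerProductSpace ℂ S] [CompleteSpace S]
    [FiniteDimensional ℂ S] [Nontrivial S]
    (AS : S →L[ℂ] S) (hAS : IsSelfAdjoint AS)
    (US : S →L[ℂ] S) (hUS : US ∈ unitary (S →L[ℂ] S))
    (δ : ℝ) (hδ0 : 0 ≤ δ) (hδ2 : δ ≤ √2)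
    {E : Type*} [NormedAddCommGroup E] [InnerProductSpace ℂ E] [CompleteSpace E]
    (I : CoherenceCost.ImplementationSet AS E) (hI : I.error US ≤ δ) :
    ENNReal.ofReal (CoherenceCost.asymmetry AS US) / ENNReal.ofReal δ
      ≤ CoherenceCost.fisher I.AE I.ρE ^ (1 / 2 : ℝ) + ENNReal.ofReal (4 * ‖AS‖) := by
  -- The infimum is isolated on the right, so that each decomposition can be treated separately; the
  -- inequality is then brought back to its first form.
  rw [← tsub_le_iff_right, one_div, ENNReal.le_rpow_inv_iff two_pos, CoherenceCost.fisher]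
  refine le_iInf fun q => le_iInf fun φ => le_iInf fun h => ?_
  rw [← ENNReal.le_rpow_inv_iff two_pos, tsub_le_iff_right]
  rcases eq_or_ne (∑' j, ENNReal.ofReal (q j) * CoherenceCost.variance I.AE (φ j)) ⊤ with hV | hV
  · simp [hV]
  · have hb := CoherenceCost.asymmetry_le hAS hUS hδ0 I hI h ENNReal.toReal_nonneg
      (ENNReal.ofReal_toReal hV).symm
    set V := (∑' j, ENNReal.ofReal (q j) * CoherenceCost.variance I.AE (φ j)).toReal with hVdef
    have hV₀ : 0 ≤ V := ENNReal.toReal_nonneg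
    have h4 : (4 * ∑' j, ENNReal.ofReal (q j) * CoherenceCost.variance I.AE (φ j)) ^ (2⁻¹ : ℝ)
        = ENNReal.ofReal (2 * √V) := by
      rw [← ENNReal.ofReal_toReal hV, ← hVdef, show (4 : ℝ≥0∞) = ENNReal.ofReal 4 by norm_num,
        ← ENNReal.ofReal_mul (by norm_num), ENNReal.ofReal_rpow_of_nonneg (by positivity)
        (by norm_num), ← one_div, ← Real.sqrt_eq_rpow, Real.sqrt_mul (by norm_num),
        show √(4 : ℝ) = 2 by rw [show (4 : ℝ) = 2 ^ 2 by norm_num, Real.sqrt_sq zero_le_two]]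
    -- This includes `δ = 0`: the product form then forces the asymmetry to vanish, and `0 / 0 = 0`
    -- in `ℝ≥0∞`.
    refine ENNReal.div_le_of_le_mul ?_
    rw [h4, ← ENNReal.ofReal_add (by positivity) (by positivity),
      ← ENNReal.ofReal_mul (by positivity)]
    exact ENNReal.ofReal_le_ofReal hb
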